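/- Let $n\ge 2$, let $T^n=\mathbb R^n/\mathbb Z^n$ with covering map $\pi:\mathbb R^n\to T^n$, and let $a_1,\dots,a_n\in\mathbb R$ be independent over $\mathbb Q$ (if $m\in\mathbb Z^n$ and $\sum_j m_ja_j=0$, then $m=0$). Let $\phi$ be the flow on $T^n$ generated by the constant vector field $X=\sum_{i=1}^n a_i\,\partial/\partial\theta_i$, that is, $\phi_t(\theta)=\theta+\pi(ta)$ with $a=(a_1,\dots,a_n)$. Let $\mathrm{Diff}(T^n)$ be the group of $C^\infty$ diffeomorphisms of $T^n$ under composition, and let $S_\phi$ be the normalizer of $\{\phi_t:t\in\mathbb R\}$ in $\mathrm{Diff}(T^n)$. Let $\rho_\phi:S_\phi\to\mathbb R^*=\mathbb R\setminus\{0\}$ be the multiplier representation: $\rho_\phi(R)$ is the unique $\alpha\in\mathbb R^*$ with $R\phi_t=\phi_{\alpha t}R$ for all $t\in\mathbb R$. Let $\Pi_\phi\subset\mathrm{GL}(n,\mathbb Z)$ be the group of all matrices $B$ such that some $R\in S_\phi$ has a lift $\hat R:\mathbb R^n\to\mathbb R^n$ (a continuous map with $R\pi=\pi\hat R$) whose derivative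 is $B$ at every point, and let $\nu_\phi:\Pi_\phi\to\rho_\phi(S_\phi)$ be the homomorphism given by $\nu_\phi(B)=\rho_\phi(R)$ for any such $R$. Then $\nu_\phi$ is an isomorphism, and for every subgroup $\Lambda$ of $\rho_\phi(S_\phi)$ the following holds. For each $\alpha\in\Lambda$ let $h_\Lambda(\alpha)$ be the map $T^n\to T^n$ that has the linear map $x\mapsto\nu_\phi^{-1}(\alpha)x$ as a lift. Then $h_\Lambda(\alpha)\in\rho_\phi^{-1}(\Lambda)$, and $h_\Lambda:\Lambda\to\rho_\phi^{-1}(\Lambda)$ is a splitting map for the extension $$\mathrm{id}_{T^n}\to\ker\rho_\phi\to\rho_\phi^{-1}(\Lambda)\xrightarrow{\,j_\Lambda\,}\Lambda\to 1,$$ where the map out of $\ker\rho_\phi$ is the inclusion and $j_\Lambda$ is the restriction of $\rho_\phi$; that is, $h_\Lambda$ is a group homomorphism and $j_\Lambda h_\Lambda=\mathrm{id}_\Lambda$. -/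

import Mathlib

open scoped Manifold ContDiff Topology

noncomputable section

namespace TorusFlow

/-- The torus `T^n = ℝ^n / ℤ^n`, as the product of `n` circles `ℝ / ℤ`. -/
abbrev Torus (n : ℕ) : Type := UnitAddTorus (Fin n)

/-- The covering map `π : ℝ^n → T^n`, reduction of each coordinate mod 1. -/
def proj {n : ℕ} (x : Fin n → ℝ) : Torus n := fun i => (x i : UnitAddCircle)

theorem proj_apply {n : ℕ} (x : Fin n → ℝ) (i : Fin n) :
    proj x i = (x i : UnitAddCircle) := rfl

theorem proj_add {n : ℕ} (x y : Fin n → ℝ) : proj (x + y) = proj x + proj y := by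
  funext i
  simp [proj]

theorem proj_neg {n : ℕ} (x : Fin n → ℝ) : proj (-x) = -proj x := by
  funext i
  simp [proj]

theorem proj_sub {n : ℕ} (x y : Fin n → ℝ) : proj (x - y) = proj x - proj y := by
  rw [sub_eq_add_neg, proj_add, proj_neg, sub_eq_add_neg]

theorem proj_zero {n : ℕ} : proj (0 : Fin n → ℝ) = 0 := by
  funext i
  simp [proj]

theorem proj_eq_zero_iff {n : ℕ} (x : Fin n → ℝ) :
    proj x = 0 ↔ ∃ m : Fin n → ℤ, ∀ i, x i = m i := by
  constructor
  · intro h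
    have : ∀ i, ∃ k : ℤ, x i = k := by
      intro i
      have hi : (x i : UnitAddCircle) = 0 := congrFun h i
      obtain ⟨k, hk⟩ := (AddCircle.coe_eq_zero_iff (1 : ℝ)).1 hi
      exact ⟨k, by rw [← hk]; simp⟩
    choose m hm using this
    exact ⟨m, hm⟩
  · rintro ⟨m, hm⟩
    funext i
    change (x i : UnitAddCircle) = 0
    exact (AddCircle.coe_eq_zero_iff (1 : ℝ)).2 ⟨m i, by rw [hm i]; simp⟩

theorem proj_eq_iff {n : ℕ} (x y : Fin n → ℝ) :
    proj x = proj y ↔ ∃ m : Fin n → ℤ, ∀ i, x i = y i + m i := by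
  rw [← sub_eq_zero, ← proj_sub, proj_eq_zero_iff]
  simp only [Pi.sub_apply, sub_eq_iff_eq_add']

theorem proj_surjective {n : ℕ} : Function.Surjective (proj (n := n)) := by
  intro θ
  choose x hx using fun i => QuotientAddGroup.mk_surjective (θ i)
  exact ⟨x, funext hx⟩

theorem continuous_proj {n : ℕ} : Continuous (proj (n := n)) :=
  continuous_pi fun i => (AddCircle.continuous_mk' (1 : ℝ)).comp (continuous_apply i)

theorem isLocalHomeomorph_proj {n : ℕ} : IsLocalHomeomorph (proj (n := n)) := by
  intro x
  choose e hx he using fun i => AddCircle.isLocalHomeomorph_coe (1 : ℝ) (x i)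
  refine ⟨OpenPartialHomeomorph.pi e, fun i _ => hx i, ?_⟩
  funext y i
  exact congrFun (he i) (y i)

/-- The smooth atlas of `T^n`: its charts are local inverses of the covering map `π`. -/
instance torusChartedSpace (n : ℕ) : ChartedSpace (Fin n → ℝ) (Torus n) :=
  isLocalHomeomorph_proj.chartedSpace proj_surjective

theorem mem_atlas_symm {n : ℕ} {e : OpenPartialHomeomorph (Torus n) (Fin n → ℝ)}
    (he : e ∈ atlas (Fin n → ℝ) (Torus n)) : ⇑e.symm = proj := by
  obtain ⟨q, rfl⟩ := he
  funext x
  simp [chartAt_self_eq]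

/-- A continuous local lift of the identity of the torus is locally a translation. -/
theorem eventually_eq_add_const {n : ℕ} {g : (Fin n → ℝ) → (Fin n → ℝ)} {x : Fin n → ℝ}
    (hg : ContinuousAt g x) (h : ∀ᶠ y in 𝓝 x, proj (g y) = proj y) :
    ∀ᶠ y in 𝓝 x, g y = y + (g x - x) := by
  obtain ⟨m, hm⟩ := (proj_eq_iff _ _).1 h.self_of_nhds
  have hc : ∀ i, ∀ᶠ y in 𝓝 x, |g y i - y i - m i| < 1 := by
    intro i
    have h1 : ContinuousAt (fun y => |g y i - y i - m i|) x := by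
      have := (continuousAt_apply i (g x)).comp hg
      have h2 := (continuous_apply (A := fun _ : Fin n => ℝ) i).continuousAt (x := x)
      exact ((this.sub h2).sub continuousAt_const).abs
    have h3 : |g x i - x i - m i| < 1 := by rw [hm i]; simp
    exact h1.eventually_lt continuousAt_const h3
  filter_upwards [h, Filter.eventually_all.2 hc] with y hy hc
  obtain ⟨k, hk⟩ := (proj_eq_iff _ _).1 hy
  funext i
  have h1 := hc i
  rw [hk i] at h1
  have h2 : y i + k i - y i - m i = ((k i - m i : ℤ) : ℝ) := by push_cast; ring
  rw [h2, ← Int.cast_abs] at h1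
  have h3 : |k i - m i| < 1 := by exact_mod_cast h1
  have h4 : k i = m i := by
    have := Int.abs_lt_one_iff.1 h3
    omega
  simp [hk i, hm i, h4]

instance torusIsManifold (n : ℕ) : IsManifold 𝓘(ℝ, Fin n → ℝ) ∞ (Torus n) := by
  apply isManifold_of_contDiffOn
  intro e e' he he' x hx
  simp only [modelWithCornersSelf_coe, modelWithCornersSelf_coe_symm, Set.preimage_id_eq,
    Set.range_id, Set.inter_univ, id_eq, Function.comp_def] at hx ⊢
  apply ContDiffAt.contDiffWithinAt
  have hc : ContinuousAt (e.symm ≫ₕ e') x :=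
    (e.symm ≫ₕ e').continuousAt hx
  have hev : ∀ᶠ y in 𝓝 x, proj ((e.symm ≫ₕ e') y) = proj y := by
    filter_upwards [(e.symm ≫ₕ e').open_source.mem_nhds hx] with y hy
    rw [OpenPartialHomeomorph.trans_source] at hy
    have h2 : e.symm y ∈ e'.source := hy.2
    change proj (e' (e.symm y)) = proj y
    rw [← mem_atlas_symm he', e'.left_inv h2, mem_atlas_symm he, mem_atlas_symm he']
  have := eventually_eq_add_const hc hev
  refine ContDiffAt.congr_of_eventuallyEq ?_ this
  exact contDiffAt_id.add contDiffAt_const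

theorem contMDiff_proj {n : ℕ} :
    ContMDiff 𝓘(ℝ, Fin n → ℝ) 𝓘(ℝ, Fin n → ℝ) ∞ (proj (n := n)) := by
  intro x
  set e := chartAt (Fin n → ℝ) (proj x) with he
  have hes : ⇑e.symm = proj := mem_atlas_symm (chart_mem_atlas _ _)
  have hmem : proj x ∈ e.source := mem_chart_source _ _
  have h1 : proj (e (proj x)) = proj x := by
    have := e.left_inv hmem
    rwa [hes] at this
  have h2 : ContMDiffAt 𝓘(ℝ, Fin n → ℝ) 𝓘(ℝ, Fin n → ℝ) ∞ proj (e (proj x)) := by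
    have := contMDiffOn_chart_symm (I := 𝓘(ℝ, Fin n → ℝ)) (n := ∞) (x := proj x)
    rw [← he, hes] at this
    exact this.contMDiffAt (e.open_target.mem_nhds (e.map_source hmem))
  have h3 : (proj (n := n)) = fun y => proj (y + (e (proj x) - x)) := by
    funext y
    rw [proj_add, proj_sub, h1, sub_self, add_zero]
  rw [h3]
  have h4 : ContMDiffAt 𝓘(ℝ, Fin n → ℝ) 𝓘(ℝ, Fin n → ℝ) ∞
      (fun y : Fin n → ℝ => y + (e (proj x) - x)) x :=
    (contDiffAt_id.add contDiffAt_const).contMDiffAt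
  refine ContMDiffAt.comp x (g := proj) ?_ h4
  simpa using h2

/-- A map of the torus that has a smooth lift is smooth. -/
theorem contMDiff_of_lift {n : ℕ} {f : Torus n → Torus n} {Q : (Fin n → ℝ) → (Fin n → ℝ)}
    (hQ : ContDiff ℝ ∞ Q) (h : ∀ x, proj (Q x) = f (proj x)) :
    ContMDiff 𝓘(ℝ, Fin n → ℝ) 𝓘(ℝ, Fin n → ℝ) ∞ f := by
  intro θ
  set e := chartAt (Fin n → ℝ) θ with he
  have hes : ⇑e.symm = proj := mem_atlas_symm (chart_mem_atlas _ _)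
  have hmem : θ ∈ e.source := mem_chart_source _ _
  have h1 : ContMDiffAt 𝓘(ℝ, Fin n → ℝ) 𝓘(ℝ, Fin n → ℝ) ∞ e θ :=
    (contMDiffOn_chart (I := 𝓘(ℝ, Fin n → ℝ)) (n := ∞) (x := θ)).contMDiffAt
      (e.open_source.mem_nhds hmem)
  have h2 : ContMDiffAt 𝓘(ℝ, Fin n → ℝ) 𝓘(ℝ, Fin n → ℝ) ∞ (fun y => proj (Q (e y))) θ :=
    (contMDiff_proj.comp hQ.contMDiff).contMDiffAt.comp θ h1
  refine h2.congr_of_eventuallyEq ?_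
  filter_upwards [e.open_source.mem_nhds hmem] with y hy
  rw [h, ← hes, e.left_inv hy]

/-- `Diff(T^n)`, the smooth diffeomorphisms of the torus. -/
abbrev Diff (n : ℕ) : Type :=
  Diffeomorph 𝓘(ℝ, Fin n → ℝ) 𝓘(ℝ, Fin n → ℝ) (Torus n) (Torus n) ∞

/-- The group structure of `Diff(T^n)`: the product is composition, `(f * g) θ = f (g θ)`. -/
instance diffGroup (n : ℕ) : Group (Diff n) where
  mul f g := g.trans f
  one := Diffeomorph.refl _ _ _
  inv f := f.symm
  mul_assoc _ _ _ := rfl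
  one_mul _ := rfl
  mul_one _ := rfl
  inv_mul_cancel f := Diffeomorph.ext fun θ => f.symm_apply_apply θ

theorem diff_mul_apply {n : ℕ} (f g : Diff n) (θ : Torus n) : (f * g) θ = f (g θ) := rfl

theorem diff_one_apply {n : ℕ} (θ : Torus n) : (1 : Diff n) θ = θ := rfl

theorem diff_inv_apply_self {n : ℕ} (f : Diff n) (θ : Torus n) : f⁻¹ (f θ) = θ :=
  f.symm_apply_apply θ

theorem diff_apply_inv_self {n : ℕ} (f : Diff n) (θ : Torus n) : f (f⁻¹ θ) = θ :=
  f.apply_symm_apply θ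

/-- The linear flow `φ_t(θ) = θ + t a (mod 1)`, the flow of the constant vector field
`∑ a_i ∂/∂θ_i` on `T^n`. -/
def linearFlow {n : ℕ} (a : Fin n → ℝ) (t : ℝ) : Diff n where
  toEquiv := Equiv.addRight (proj (t • a))
  contMDiff_toFun := contMDiff_of_lift (Q := fun x => x + t • a)
    (contDiff_id.add contDiff_const) fun x => by simp [proj_add]
  contMDiff_invFun := contMDiff_of_lift (Q := fun x => x + -(t • a))
    (contDiff_id.add contDiff_const) fun x => by simp [proj_add, proj_neg]

theorem linearFlow_apply {n : ℕ} (a : Fin n → ℝ) (t : ℝ) (θ : Torus n) :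
    linearFlow a t θ = θ + proj (t • a) := rfl

theorem linearFlow_zero {n : ℕ} (a : Fin n → ℝ) : linearFlow a 0 = 1 :=
  Diffeomorph.ext fun θ => by
    rw [linearFlow_apply, zero_smul, proj_zero, add_zero, diff_one_apply]

theorem linearFlow_add {n : ℕ} (a : Fin n → ℝ) (s t : ℝ) :
    linearFlow a (s + t) = linearFlow a s * linearFlow a t :=
  Diffeomorph.ext fun θ => by
    rw [diff_mul_apply, linearFlow_apply, linearFlow_apply, linearFlow_apply, add_smul, proj_add,
      add_assoc, add_comm (proj (s • a))]

/-- The orbits of the linear flow are integral curves of the constant vector field whose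
coefficients in the charts of the torus are `a_1, …, a_n`. -/
theorem linearFlow_isMIntegralCurve {n : ℕ} (a : Fin n → ℝ) (θ : Torus n) :
    IsMIntegralCurve (I := 𝓘(ℝ, Fin n → ℝ)) (fun t => linearFlow a t θ) (fun _ => a) := by
  intro t
  obtain ⟨x, rfl⟩ := proj_surjective θ
  have hcurve : (fun t => linearFlow a t (proj x)) = fun t => proj (x + t • a) := by
    funext t
    rw [linearFlow_apply, proj_add]
  set p : Torus n := proj (x + t • a) with hp
  have hflow : linearFlow a t (proj x) = p := congrFun hcurve t
  set e := chartAt (Fin n → ℝ) p with he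
  have hes : ⇑e.symm = proj := mem_atlas_symm (chart_mem_atlas _ _)
  have hmem : p ∈ e.source := mem_chart_source _ _
  have hcont : ContinuousAt (fun y => e (proj y)) (x + t • a) :=
    ContinuousAt.comp (e.continuousAt hmem) continuous_proj.continuousAt
  have hev : ∀ᶠ y in 𝓝 (x + t • a), proj (e (proj y)) = proj y := by
    filter_upwards [continuous_proj.continuousAt.preimage_mem_nhds
      (e.open_source.mem_nhds hmem)] with y hy
    have := e.left_inv hy
    rwa [hes] at this
  have hloc := eventually_eq_add_const hcont hev
  have hpath : ContinuousAt (fun s : ℝ => x + s • a) t := by fun_prop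
  refine ⟨?_, ?_⟩
  · rw [hcurve]
    exact (continuous_proj.comp (by fun_prop : Continuous fun s : ℝ => x + s • a)).continuousAt
  · simp only [writtenInExtChartAt, extChartAt, mfld_simps]
    rw [hflow, ← he]
    have h1 : HasFDerivAt (fun s : ℝ => x + s • a + (e p - (x + t • a)))
        ((1 : ℝ →L[ℝ] ℝ).smulRight a) t :=
      (((hasFDerivAt_id t).smul_const a).const_add x).add_const _
    have h2 : HasFDerivAt (fun s : ℝ => e (linearFlow a s (proj x)))
        ((1 : ℝ →L[ℝ] ℝ).smulRight a) t := by
      refine h1.congr_of_eventuallyEq ?_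
      filter_upwards [hpath.eventually hloc] with s hs
      have := congrFun hcurve s
      rw [← hs]
      exact congrArg e this
    exact h2.hasFDerivWithinAt

/-- Real numbers `a_1, …, a_n` are independent over `ℚ`: no nontrivial integer relation. -/
def RationallyIndependent {n : ℕ} (a : Fin n → ℝ) : Prop :=
  ∀ m : Fin n → ℤ, ∑ j, (m j : ℝ) * a j = 0 → ∀ j, m j = 0

/-- `F_φ = {φ_t : t ∈ ℝ}`, as a subgroup of `Diff(T^n)`. -/
def flowGroup {n : ℕ} (a : Fin n → ℝ) : Subgroup (Diff n) where
  carrier := Set.range (linearFlow a)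
  mul_mem' := by
    rintro _ _ ⟨s, rfl⟩ ⟨t, rfl⟩
    exact ⟨s + t, linearFlow_add a s t⟩
  one_mem' := ⟨0, linearFlow_zero a⟩
  inv_mem' := by
    rintro _ ⟨t, rfl⟩
    refine ⟨-t, eq_inv_of_mul_eq_one_left ?_⟩
    rw [← linearFlow_add, neg_add_cancel, linearFlow_zero]

/-- The generalized symmetry group `S_φ`: the normalizer of `F_φ` in `Diff(T^n)`. -/
def symmetryGroup {n : ℕ} (a : Fin n → ℝ) : Subgroup (Diff n) :=
  Subgroup.normalizer (flowGroup a : Set (Diff n))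

/-- `α` is a multiplier of `R`: `R φ_t = φ_{α t} R` for all `t`. -/
def IsMultiplier {n : ℕ} (a : Fin n → ℝ) (R : Diff n) (α : ℝˣ) : Prop :=
  ∀ t : ℝ, R * linearFlow a t = linearFlow a ((α : ℝ) * t) * R

theorem eq_zero_of_countable_range {f : ℝ → ℝ} (hf : Continuous f) (h0 : f 0 = 0)
    (hc : (Set.range f).Countable) (t : ℝ) : f t = 0 := by
  rw [← h0]
  exact hc.isTotallyDisconnected _ (subset_refl _) (isPreconnected_range hf) ⟨t, rfl⟩ ⟨0, rfl⟩

/-- An integer relation between two of the numbers `a_1, …, a_n` is trivial. -/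
theorem RationallyIndependent.eq_zero {n : ℕ} {a : Fin n → ℝ} (ha : RationallyIndependent a)
    {i j : Fin n} (hij : i ≠ j) {p q : ℤ} (h : (p : ℝ) * a i + (q : ℝ) * a j = 0) :
    p = 0 ∧ q = 0 := by
  have key := ha (Pi.single i p + Pi.single j q) (by
    simp only [Pi.add_apply, Int.cast_add, add_mul, Finset.sum_add_distrib]
    rw [Finset.sum_eq_single i, Finset.sum_eq_single j]
    · simpa using h
    · intro b _ hb
      simp [Pi.single_eq_of_ne hb]
    · simp
    · intro b _ hb
      simp [Pi.single_eq_of_ne hb]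
    · simp)
  have h1 := key i
  have h2 := key j
  simp [Pi.single_eq_of_ne hij, Pi.single_eq_of_ne hij.symm] at h1 h2
  exact ⟨h1, h2⟩

theorem exists_ne_of_two_le {n : ℕ} (hn : 2 ≤ n) (i : Fin n) : ∃ j : Fin n, i ≠ j := by
  have : Nontrivial (Fin n) := Fin.nontrivial_iff_two_le.2 hn
  obtain ⟨j, hj⟩ := exists_ne i
  exact ⟨j, hj.symm⟩

theorem RationallyIndependent.ne_zero {n : ℕ} {a : Fin n → ℝ} (ha : RationallyIndependent a)
    (hn : 2 ≤ n) (i : Fin n) : a i ≠ 0 := by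
  intro h
  obtain ⟨j, hij⟩ := exists_ne_of_two_le hn i
  exact one_ne_zero (ha.eq_zero hij (p := 1) (q := 0) (by simp [h])).1

theorem linearFlow_injective {n : ℕ} (hn : 2 ≤ n) {a : Fin n → ℝ}
    (ha : RationallyIndependent a) : Function.Injective (linearFlow a) := by
  intro s t h
  have h1 : linearFlow a s 0 = linearFlow a t 0 := by rw [h]
  rw [linearFlow_apply, linearFlow_apply, zero_add, zero_add, proj_eq_iff] at h1
  obtain ⟨m, hm⟩ := h1
  simp only [Pi.smul_apply, smul_eq_mul] at hm
  have i : Fin n := ⟨0, by omega⟩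
  obtain ⟨j, hij⟩ := exists_ne_of_two_le hn i
  have h2 : ((m j : ℤ) : ℝ) * a i + ((-m i : ℤ) : ℝ) * a j = 0 := by
    push_cast
    linear_combination a j * hm i - a i * hm j
  have h3 : m i = 0 := neg_eq_zero.1 (ha.eq_zero hij h2).2
  have h4 := hm i
  rw [h3, Int.cast_zero, add_zero] at h4
  exact mul_right_cancel₀ (ha.ne_zero hn i) h4

/-- Every generalized symmetry has a multiplier. -/
theorem exists_isMultiplier {n : ℕ} (hn : 2 ≤ n) {a : Fin n → ℝ}
    (ha : RationallyIndependent a) {R : Diff n} (hR : R ∈ symmetryGroup a) :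
    ∃ α : ℝˣ, IsMultiplier a R α := by
  have hex : ∀ t, ∃ s, linearFlow a s = R * linearFlow a t * R⁻¹ := fun t =>
    (Subgroup.mem_normalizer_iff.1 hR (linearFlow a t)).1 ⟨t, rfl⟩
  choose s hs using hex
  have hinj := linearFlow_injective hn ha
  have hadd : ∀ t u, s (t + u) = s t + s u := by
    intro t u
    apply hinj
    rw [linearFlow_add, hs, hs, hs, linearFlow_add]
    group
  let i : Fin n := ⟨0, by omega⟩
  -- lift the orbit `t ↦ R φ_t R⁻¹ (0)` to a continuous path in `ℝ^n` starting at the origin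
  have hcont : Continuous fun t : ℝ => R (linearFlow a t (R⁻¹ 0)) := by
    refine R.continuous.comp ?_
    have : (fun t : ℝ => linearFlow a t (R⁻¹ 0)) = fun t : ℝ => R⁻¹ 0 + proj (t • a) := rfl
    rw [this]
    exact continuous_const.add (continuous_proj.comp (by fun_prop))
  have hval : ∀ t, R (linearFlow a t (R⁻¹ 0)) = proj (s t • a) := by
    intro t
    have : linearFlow a (s t) 0 = (R * linearFlow a t * R⁻¹) 0 := by rw [hs]
    rw [linearFlow_apply, zero_add] at this
    rw [this]
    rfl
  have hs0 : s 0 = 0 := by simpa using hadd 0 0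
  have hlift : ∀ k : Fin n, ∃ Γ : ℝ → ℝ, Continuous Γ ∧ Γ 0 = 0 ∧
      ∀ t, ((Γ t : ℝ) : UnitAddCircle) = R (linearFlow a t (R⁻¹ 0)) k := by
    intro k
    obtain ⟨F, ⟨hF0, hF⟩, -⟩ :=
      (AddCircle.isCoveringMap_coe (1 : ℝ)).existsUnique_continuousMap_lifts
        (⟨fun t : ℝ => R (linearFlow a t (R⁻¹ 0)) k, (continuous_apply k).comp hcont⟩ : C(ℝ, _))
        0 0 (by
          change _ = R (linearFlow a 0 (R⁻¹ 0)) k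
          rw [hval, hs0, zero_smul, proj_zero]
          simp)
    exact ⟨F, F.continuous, hF0, fun t => congrFun hF t⟩
  choose Γ hΓc hΓ0 hΓ using hlift
  have hm : ∀ t, ∃ m : Fin n → ℤ, ∀ k, Γ k t = s t * a k + m k := by
    intro t
    refine (proj_eq_iff (fun k => Γ k t) (s t • a)).1 ?_
    rw [← hval]
    funext k
    exact hΓ k t
  choose m hm using hm
  have hΓs : ∀ t, Γ i t = s t * a i := by
    intro t
    obtain ⟨j, hij⟩ := exists_ne_of_two_le hn i
    have hrel : ∀ t, a j * Γ i t - a i * Γ j t = (m t i : ℝ) * a j - (m t j : ℝ) * a i := by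
      intro t
      rw [hm, hm]
      ring
    have hz := eq_zero_of_countable_range (f := fun t => a j * Γ i t - a i * Γ j t)
      ((continuous_const.mul (hΓc i)).sub (continuous_const.mul (hΓc j)))
      (by simp [hΓ0])
      (by
        refine (Set.countable_range
          (fun pq : ℤ × ℤ => (pq.1 : ℝ) * a j - (pq.2 : ℝ) * a i)).mono ?_
        rintro _ ⟨t, rfl⟩
        exact ⟨(m t i, m t j), (hrel t).symm⟩) t
    have h2 : ((-m t j : ℤ) : ℝ) * a i + ((m t i : ℤ) : ℝ) * a j = 0 := by
      push_cast
      have := hrel t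
      have hz' : a j * Γ i t - a i * Γ j t = 0 := hz
      linarith
    rw [hm, (ha.eq_zero hij h2).2, Int.cast_zero, add_zero]
  have hsc : Continuous s := by
    have : s = fun t => Γ i t / a i := by
      funext t
      rw [hΓs, mul_div_cancel_right₀ _ (ha.ne_zero hn i)]
    rw [this]
    exact (hΓc i).div_const _
  have hlin : ∀ t, s t = s 1 * t := by
    intro t
    have := (AddMonoidHom.mk' s hadd).toRealLinearMap hsc |>.map_smul t (1 : ℝ)
    rw [smul_eq_mul, mul_one, smul_eq_mul, mul_comm] at this
    exact this
  have hne : s 1 ≠ 0 := by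
    intro h
    have h1 := hs 1
    rw [h, linearFlow_zero] at h1
    have h2 : linearFlow a 1 = linearFlow a 0 := by
      rw [linearFlow_zero]
      have h3 := eq_mul_inv_iff_mul_eq.1 h1
      rw [one_mul] at h3
      exact (mul_eq_left.1 h3.symm)
    exact one_ne_zero (hinj h2)
  refine ⟨Units.mk0 _ hne, fun t => ?_⟩
  rw [Units.val_mk0, ← hlin, hs, inv_mul_cancel_right]

theorem IsMultiplier.unique {n : ℕ} (hn : 2 ≤ n) {a : Fin n → ℝ}
    (ha : RationallyIndependent a) {R : Diff n} {α β : ℝˣ}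
    (hα : IsMultiplier a R α) (hβ : IsMultiplier a R β) : α = β := by
  have h : linearFlow a (α * 1) = linearFlow a (β * 1) :=
    mul_right_cancel ((hα 1).symm.trans (hβ 1))
  have := linearFlow_injective hn ha h
  rw [mul_one, mul_one] at this
  exact Units.ext this

/-- The multiplier representation `ρ_φ : S_φ → ℝ^*`, sending `R` to the unique `α` such that
`R φ_t = φ_{α t} R` for all `t`. -/
def multiplierRep {n : ℕ} (hn : 2 ≤ n) {a : Fin n → ℝ} (ha : RationallyIndependent a) :
    symmetryGroup a →* ℝˣ :=
  MonoidHom.mk' (fun R => (exists_isMultiplier hn ha R.2).choose) (by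
    intro R Q
    refine IsMultiplier.unique hn ha (exists_isMultiplier hn ha (R * Q).2).choose_spec ?_
    have hR := (exists_isMultiplier hn ha R.2).choose_spec
    have hQ := (exists_isMultiplier hn ha Q.2).choose_spec
    intro t
    rw [Subgroup.coe_mul, mul_assoc, hQ, ← mul_assoc, hR, mul_assoc, Units.val_mul, mul_assoc])

theorem multiplierRep_isMultiplier {n : ℕ} (hn : 2 ≤ n) {a : Fin n → ℝ}
    (ha : RationallyIndependent a) (R : symmetryGroup a) :
    IsMultiplier a R (multiplierRep hn ha R) :=
  (exists_isMultiplier hn ha R.2).choose_spec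

/-- The extension `ker ρ_φ → ρ_φ⁻¹(Λ) → Λ` for a subgroup `Λ` of the multiplier group
`ρ_φ(S_φ)`: the first map is the inclusion, the second the restriction of `ρ_φ`. -/
def multiplierExtension {n : ℕ} (hn : 2 ≤ n) {a : Fin n → ℝ} (ha : RationallyIndependent a)
    (Λ : Subgroup ℝˣ) (hΛ : Λ ≤ (multiplierRep hn ha).range) :
    GroupExtension (multiplierRep hn ha).ker (Λ.comap (multiplierRep hn ha)) Λ where
  inl := Subgroup.inclusion ((multiplierRep hn ha).ker_le_comap Λ)
  rightHom := (multiplierRep hn ha).subgroupComap Λ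
  inl_injective := Subgroup.inclusion_injective _
  range_inl_eq_ker_rightHom := by
    ext R
    constructor
    · rintro ⟨Q, rfl⟩
      exact Subtype.ext Q.2
    · intro h
      exact ⟨⟨R, congrArg Subtype.val h⟩, rfl⟩
  rightHom_surjective := by
    rintro ⟨α, hα⟩
    obtain ⟨R, rfl⟩ := hΛ hα
    exact ⟨⟨R, hα⟩, rfl⟩

/-- The linear map `x ↦ B x` of `ℝ^n` given by an integer matrix `B ∈ GL(n, ℤ)`. -/
def linMap {n : ℕ} (B : Matrix.GeneralLinearGroup (Fin n) ℤ) :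
    (Fin n → ℝ) →L[ℝ] (Fin n → ℝ) :=
  LinearMap.toContinuousLinearMap
    (Matrix.toLin' ((B : Matrix (Fin n) (Fin n) ℤ).map ((↑) : ℤ → ℝ)))

theorem linMap_apply {n : ℕ} (B : Matrix.GeneralLinearGroup (Fin n) ℤ) (x : Fin n → ℝ) :
    linMap B x = fun i => ∑ j, (B i j : ℝ) * x j := by
  funext i
  simp [linMap, Matrix.mulVec, dotProduct]

theorem linMap_one {n : ℕ} (x : Fin n → ℝ) :
    linMap (1 : Matrix.GeneralLinearGroup (Fin n) ℤ) x = x := by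
  funext i
  simp [linMap_apply, Matrix.one_apply]

theorem linMap_mul {n : ℕ} (B C : Matrix.GeneralLinearGroup (Fin n) ℤ) (x : Fin n → ℝ) :
    linMap (B * C) x = linMap B (linMap C x) := by
  have h : ((B * C : Matrix.GeneralLinearGroup (Fin n) ℤ) : Matrix (Fin n) (Fin n) ℤ).map
      ((↑) : ℤ → ℝ) = (B : Matrix (Fin n) (Fin n) ℤ).map ((↑) : ℤ → ℝ) *
        (C : Matrix (Fin n) (Fin n) ℤ).map ((↑) : ℤ → ℝ) := by
    rw [Units.val_mul]
    exact Matrix.map_mul (f := Int.castRingHom ℝ)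
  simp only [linMap, h, LinearMap.coe_toContinuousLinearMap', Matrix.toLin'_mul,
    LinearMap.comp_apply]

/-- `Q : ℝ^n → ℝ^n` is a lift of `R : T^n → T^n`. -/
def IsLift {n : ℕ} (Q : (Fin n → ℝ) → (Fin n → ℝ)) (R : Torus n → Torus n) : Prop :=
  Continuous Q ∧ ∀ x, R (proj x) = proj (Q x)

/-- The matrix `B` is the derivative, at every point, of some lift of `R`. -/
def HasLiftDeriv {n : ℕ} (R : Diff n) (B : Matrix.GeneralLinearGroup (Fin n) ℤ) : Prop :=
  ∃ Q : (Fin n → ℝ) → (Fin n → ℝ), IsLift Q R ∧ ∀ x, HasFDerivAt Q (linMap B) x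

theorem hasLiftDeriv_iff {n : ℕ} (R : Diff n) (B : Matrix.GeneralLinearGroup (Fin n) ℤ) :
    HasLiftDeriv R B ↔ ∃ c : Fin n → ℝ, ∀ x, R (proj x) = proj (linMap B x + c) := by
  constructor
  · rintro ⟨Q, ⟨-, hQ⟩, hd⟩
    refine ⟨Q 0, fun x => ?_⟩
    have hconst : (fun y => Q y - linMap B y) x = (fun y => Q y - linMap B y) 0 := by
      have hd' : ∀ y, HasFDerivAt (fun y => Q y - linMap B y) (linMap B - linMap B) y :=
        fun y => (hd y).sub (linMap B).hasFDerivAt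
      refine is_const_of_fderiv_eq_zero (𝕜 := ℝ) (fun y => (hd' y).differentiableAt)
        (fun y => ?_) x 0
      rw [(hd' y).fderiv, sub_self]
    simp only [map_zero, sub_zero] at hconst
    rw [hQ, ← hconst, add_sub_cancel]
  · rintro ⟨c, hc⟩
    exact ⟨fun x => linMap B x + c, ⟨(linMap B).continuous.add continuous_const, hc⟩,
      fun x => (linMap B).hasFDerivAt.add_const c⟩

/-- `Π_φ`, the group of matrices `B ∈ GL(n, ℤ)` that are the derivative of a lift of some
`R ∈ S_φ`. -/
def liftMatrixGroup {n : ℕ} (a : Fin n → ℝ) :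
    Subgroup (Matrix.GeneralLinearGroup (Fin n) ℤ) where
  carrier := {B | ∃ R ∈ symmetryGroup a, HasLiftDeriv R B}
  mul_mem' := by
    rintro B C ⟨R, hR, hB⟩ ⟨Q, hQ, hC⟩
    obtain ⟨b, hb⟩ := (hasLiftDeriv_iff _ _).1 hB
    obtain ⟨c, hc⟩ := (hasLiftDeriv_iff _ _).1 hC
    refine ⟨R * Q, mul_mem hR hQ, (hasLiftDeriv_iff _ _).2 ⟨linMap B c + b, fun x => ?_⟩⟩
    rw [diff_mul_apply, hc, hb, linMap_mul, map_add, add_assoc]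
  one_mem' := ⟨1, one_mem _, (hasLiftDeriv_iff _ _).2 ⟨0, fun x => by
    rw [linMap_one, add_zero, diff_one_apply]⟩⟩
  inv_mem' := by
    rintro B ⟨R, hR, hB⟩
    obtain ⟨b, hb⟩ := (hasLiftDeriv_iff _ _).1 hB
    refine ⟨R⁻¹, inv_mem hR, (hasLiftDeriv_iff _ _).2 ⟨-linMap B⁻¹ b, fun x => ?_⟩⟩
    have h : proj x = R (proj (linMap B⁻¹ x + -linMap B⁻¹ b)) := by
      rw [hb, map_add, map_neg, ← linMap_mul, ← linMap_mul, mul_inv_cancel, linMap_one,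
        linMap_one, neg_add_cancel_right]
    rw [h, diff_inv_apply_self]

/-- If `B` is the derivative of a lift of a generalized symmetry `R`, then `a` is an eigenvector
of `B` for the eigenvalue `ρ_φ(R)`. -/
theorem linMap_eq_multiplier_smul {n : ℕ} (hn : 2 ≤ n) {a : Fin n → ℝ}
    (ha : RationallyIndependent a) (R : symmetryGroup a)
    {B : Matrix.GeneralLinearGroup (Fin n) ℤ} (hB : HasLiftDeriv R B) :
    linMap B a = (multiplierRep hn ha R : ℝ) • a := by
  obtain ⟨b, hb⟩ := (hasLiftDeriv_iff _ _).1 hB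
  have hρ := multiplierRep_isMultiplier hn ha R
  set α : ℝ := (multiplierRep hn ha R : ℝ) with hα
  have key : ∀ t : ℝ, proj (t • (linMap B a - α • a)) = 0 := by
    intro t
    have h1 : ((R : Diff n) * linearFlow a t) (proj 0) =
        (linearFlow a (α * t) * (R : Diff n)) (proj 0) := by rw [hρ t]
    rw [diff_mul_apply, diff_mul_apply, linearFlow_apply, linearFlow_apply, ← proj_add, hb, hb,
      ← proj_add, ← sub_eq_zero, ← proj_sub] at h1
    rw [← h1]
    congr 1
    simp only [map_zero, zero_add, map_smul, smul_sub, smul_smul]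
    rw [mul_comm t α]
    abel
  have hz : linMap B a - α • a = 0 := by
    funext i
    set v := (linMap B a - α • a) i with hv
    by_contra hne
    obtain ⟨m, hm⟩ := (proj_eq_zero_iff _).1 (key (1 / (2 * v)))
    have h2 := hm i
    rw [Pi.smul_apply, smul_eq_mul, ← hv] at h2
    have hne' : v ≠ 0 := hne
    have h3 : ((2 * m i : ℤ) : ℝ) = ((1 : ℤ) : ℝ) := by
      push_cast
      rw [← h2]
      field_simp
    have h4 : 2 * m i = 1 := by exact_mod_cast h3
    omega
  exact sub_eq_zero.1 hz

theorem multiplier_eq_of_linMap_eq {n : ℕ} (hn : 2 ≤ n) {a : Fin n → ℝ}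
    (ha : RationallyIndependent a) {α β : ℝˣ} (h : (α : ℝ) • a = (β : ℝ) • a) : α = β := by
  have h1 := congrFun h ⟨0, by omega⟩
  exact Units.ext (mul_right_cancel₀ (ha.ne_zero hn _) h1)

/-- The homomorphism `ν_φ : Π_φ → ρ_φ(S_φ)`, `ν_φ(B) = ρ_φ(R)` for any `R ∈ S_φ` with a lift
whose derivative is `B`. -/
def liftMultiplier {n : ℕ} (hn : 2 ≤ n) {a : Fin n → ℝ} (ha : RationallyIndependent a) :
    liftMatrixGroup a →* (multiplierRep hn ha).range :=
  MonoidHom.mk' (fun B => ⟨multiplierRep hn ha ⟨B.2.choose, B.2.choose_spec.1⟩, _, rfl⟩) (by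
    intro B C
    apply Subtype.ext
    apply multiplier_eq_of_linMap_eq hn ha
    have hBC := linMap_eq_multiplier_smul hn ha ⟨(B * C).2.choose, (B * C).2.choose_spec.1⟩
      (B * C).2.choose_spec.2
    have hB := linMap_eq_multiplier_smul hn ha ⟨B.2.choose, B.2.choose_spec.1⟩
      B.2.choose_spec.2
    have hC := linMap_eq_multiplier_smul hn ha ⟨C.2.choose, C.2.choose_spec.1⟩
      C.2.choose_spec.2
    rw [← hBC, Subgroup.coe_mul, linMap_mul, hC, map_smul, hB, smul_smul, mul_comm]
    rfl)

/-- `ν_φ` is well defined: it does not depend on the choice of `R`. -/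
theorem liftMultiplier_eq {n : ℕ} (hn : 2 ≤ n) {a : Fin n → ℝ} (ha : RationallyIndependent a)
    (B : liftMatrixGroup a) (R : symmetryGroup a) (hR : HasLiftDeriv R B.1) :
    ((liftMultiplier hn ha B : (multiplierRep hn ha).range) : ℝˣ) = multiplierRep hn ha R := by
  apply multiplier_eq_of_linMap_eq hn ha
  rw [← linMap_eq_multiplier_smul hn ha R hR]
  exact (linMap_eq_multiplier_smul hn ha ⟨B.2.choose, B.2.choose_spec.1⟩
    B.2.choose_spec.2).symm

end TorusFlow

end

/-! Everything rests on the rigidity of generalized symmetries: each `R` in `S_φ` is affine, `R θ =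
B θ + R 0` with `B` an integer matrix. If `α` is the multiplier of `R`, then for fixed `s` the
displacement `R (θ + s) - R θ` is flow invariant in `θ`, since both terms move by the same `π(αta)`.
Continuous flow invariant functions are constant (`eq_of_flow_invariant`, by Fourier coefficients),
so `R - R 0` is a continuous homomorphism, hence given by integer linear forms
(`exists_eq_sum_zsmul`). The same applies to `R⁻¹`, so `B` is invertible over `ℤ`, and `ν_φ` is
surjective.

The relation `B a = ν_φ(B) a` gives the rest. Independence of the `a_j` makes `B` recoverable from
`B a`, so `ν_φ` is injective. Conversely, having `a` as an eigenvector is all that the linear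
automorphism of `B`, with no translation part, needs in order to lie in `S_φ` with multiplier
`ν_φ(B)`. Composing `B ↦` (linear automorphism) with `ν_φ⁻¹` gives the splitting. -/

noncomputable section

namespace TorusFlow

/-! ### Fourier coefficients, translations and irrational flows -/

open UnitAddTorus MeasureTheory

attribute [local instance] instMeasureSpaceUnitAddCircle
  instIsAddHaarMeasureUnitAddCircleVolume
  instIsProbabilityMeasureUnitAddCircleVolume

theorem mFourier_eq_toCircle {n : ℕ} (m : Fin n → ℤ) (θ : Torus n) :
    mFourier m θ = (AddCircle.toCircle (∑ j, m j • θ j) : ℂ) := by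
  have h : ∀ s : Finset (Fin n), ((AddCircle.toCircle (∑ j ∈ s, m j • θ j) : Circle) : ℂ) =
      ∏ j ∈ s, (AddCircle.toCircle (m j • θ j) : ℂ) := by
    intro s
    induction s using Finset.cons_induction with
    | empty => simp
    | cons j s hj ih =>
      rw [Finset.sum_cons, Finset.prod_cons, AddCircle.toCircle_add, Circle.coe_mul, ih]
  rw [h]
  rfl

theorem mFourier_apply_add {n : ℕ} (m : Fin n → ℤ) (θ s : Torus n) :
    mFourier m (θ + s) = mFourier m θ * mFourier m s := by
  simp only [mFourier_eq_toCircle, Pi.add_apply, smul_add, Finset.sum_add_distrib,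
    AddCircle.toCircle_add, Circle.coe_mul]

/-- Translation invariance of Haar measure, after splitting off the factor `mFourier m s` from the
character at `θ + s`. -/
theorem mFourierCoeff_comp_add_right {n : ℕ} (f : Torus n → ℂ) (s : Torus n) (m : Fin n → ℤ) :
    mFourierCoeff (fun θ => f (θ + s)) m = mFourier m s * mFourierCoeff f m := by
  have h : ∀ θ, mFourier (-m) θ • f (θ + s) =
      (fun u => mFourier m s * (mFourier (-m) u • f u)) (θ + s) := by
    intro θ
    have h1 : mFourier m s * mFourier (-m) s = 1 := by
      rw [← mFourier_add, add_neg_cancel, mFourier_zero, ContinuousMap.one_apply]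
    simp only [smul_eq_mul, mFourier_apply_add]
    linear_combination (-(mFourier (-m) θ * f (θ + s))) * h1
  simp only [mFourierCoeff]
  rw [integral_congr_ae (Filter.Eventually.of_forall h), ← integral_const_mul]
  exact integral_add_right_eq_self (μ := (volume : Measure (Torus n)))
    (fun u => mFourier m s * (mFourier (-m) u • f u)) s

/-- A continuous function that is an eigenvector of the translation by `s` has Fourier
coefficients only at characters taking the eigenvalue at `s`. -/
theorem eigenvalue_eq_of_mFourierCoeff_ne_zero {n : ℕ} {f : Torus n → ℂ} {s : Torus n} {c : ℂ}
    (h : ∀ θ, f (θ + s) = c * f θ) {m : Fin n → ℤ} (hm : mFourierCoeff f m ≠ 0) :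
    c = mFourier m s := by
  have h1 := mFourierCoeff_comp_add_right f s m
  simp only [h] at h1
  have h2 : mFourierCoeff (fun θ => c * f θ) m = c * mFourierCoeff f m := by
    simp only [mFourierCoeff, ← integral_const_mul, smul_eq_mul]
    congr 1
    funext t
    ring
  exact mul_right_cancel₀ hm (h2.symm.trans h1)

/-- Coefficients supported at `0` are summable, so the Fourier series of the continuous `f`
converges pointwise to `f` and consists of one term. -/
theorem eq_const_of_mFourierCoeff_eq_zero {n : ℕ} (f : C(Torus n, ℂ))
    (h : ∀ m ≠ 0, mFourierCoeff f m = 0) (θ : Torus n) : f θ = mFourierCoeff f 0 := by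
  have hs : Summable (mFourierCoeff f) := (hasSum_single 0 h).summable
  have h1 := hasSum_mFourier_series_apply_of_summable hs θ
  have h2 := hasSum_single (f := fun i => mFourierCoeff f i • mFourier i θ) 0
    fun m hm => by simp [h m hm]
  simpa [mFourier_zero] using h1.unique h2

theorem eq_zero_of_forall_mul_mem_int {v : ℝ} (h : ∀ t : ℝ, ∃ k : ℤ, t * v = k) : v = 0 := by
  by_contra hv
  -- This time makes `t * v = 1/2`, which is not an integer.
  obtain ⟨k, hk⟩ := h (1 / (2 * v))
  have h1 : ((2 * k : ℤ) : ℝ) = ((1 : ℤ) : ℝ) := by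
    push_cast
    rw [← hk]
    field_simp
  have : 2 * k = 1 := by exact_mod_cast h1
  omega

theorem sum_zsmul_proj {n : ℕ} (m : Fin n → ℤ) (x : Fin n → ℝ) :
    ∑ j, m j • proj x j = ((∑ j, (m j : ℝ) * x j : ℝ) : UnitAddCircle) := by
  have h := map_sum (QuotientAddGroup.mk' (AddSubgroup.zmultiples (1 : ℝ)))
    (fun j => (m j : ℝ) * x j) Finset.univ
  refine Eq.trans ?_ h.symm
  refine Finset.sum_congr rfl fun j _ => ?_
  rw [← zsmul_eq_mul, map_zsmul]
  rfl

/-- Along the orbit of `0` the character is `exp(2πi t ∑ m_j a_j)`. If it is always `1`, then `t ∑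
m_j a_j` is an integer for every real `t`, so the sum vanishes and independence applies. -/
theorem eq_zero_of_mFourier_flow_eq_one {n : ℕ} {a : Fin n → ℝ} (ha : RationallyIndependent a)
    {m : Fin n → ℤ} (h : ∀ t : ℝ, mFourier m (proj (t • a)) = 1) : m = 0 := by
  refine funext (ha m (eq_zero_of_forall_mul_mem_int fun t => ?_))
  have h1 := h t
  rw [mFourier_eq_toCircle, Circle.coe_eq_one, ← AddCircle.toCircle_zero (T := 1)] at h1
  have h2 := AddCircle.injective_toCircle one_ne_zero h1
  rw [sum_zsmul_proj] at h2
  obtain ⟨k, hk⟩ := (AddCircle.coe_eq_zero_iff (1 : ℝ)).1 h2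
  refine ⟨k, ?_⟩
  rw [zsmul_eq_mul, mul_one] at hk
  rw [hk, Finset.mul_sum]
  refine Finset.sum_congr rfl fun j _ => ?_
  simp only [Pi.smul_apply, smul_eq_mul]
  ring

/-- A continuous function invariant under an irrational linear flow is constant. -/
theorem eq_of_flow_invariant {n : ℕ} {a : Fin n → ℝ} (ha : RationallyIndependent a)
    {f : Torus n → ℂ} (hf : Continuous f) (h : ∀ (t : ℝ) θ, f (θ + proj (t • a)) = f θ)
    (θ θ' : Torus n) : f θ = f θ' := by
  have hz : ∀ m ≠ 0, mFourierCoeff (⟨f, hf⟩ : C(Torus n, ℂ)) m = 0 := by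
    intro m hm
    by_contra hne
    refine hm (eq_zero_of_mFourier_flow_eq_one ha fun t => ?_)
    -- Invariance means eigenvalue `1` for every `φ_t`, so a frequency present in `f` has a
    -- character trivial along the flow.
    exact (eigenvalue_eq_of_mFourierCoeff_ne_zero (f := f) (s := proj (t • a)) (c := 1)
      (fun θ => by rw [h, one_mul]) hne).symm
  exact (eq_const_of_mFourierCoeff_eq_zero ⟨f, hf⟩ hz θ).trans
    (eq_const_of_mFourierCoeff_eq_zero ⟨f, hf⟩ hz θ').symm

/-- Continuous homomorphisms from the torus to the circle are integer linear forms. -/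
theorem exists_eq_sum_zsmul {n : ℕ} {g : Torus n → UnitAddCircle} (hg : Continuous g)
    (hadd : ∀ θ s, g (θ + s) = g θ + g s) :
    ∃ m : Fin n → ℤ, ∀ θ, g θ = ∑ j, m j • θ j := by
  set f : C(Torus n, ℂ) := ⟨fun θ => (AddCircle.toCircle (g θ) : ℂ),
    continuous_induced_dom.comp (AddCircle.continuous_toCircle.comp hg)⟩ with hf
  -- If all coefficients vanished, `f` would be zero, but its values lie on the unit circle.
  have hm : ∃ m, mFourierCoeff f m ≠ 0 := by
    by_contra! h
    have h0 := eq_const_of_mFourierCoeff_eq_zero f (fun m _ => h m) 0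
    rw [h 0] at h0
    exact Circle.coe_ne_zero _ h0
  obtain ⟨m, hm⟩ := hm
  refine ⟨m, fun s => ?_⟩
  -- As a homomorphism, `f` is an eigenvector of every translation, with eigenvalue `f s`. The
  -- frequency `m` was fixed before `s`, so one `m` serves all `s`.
  have h1 := eigenvalue_eq_of_mFourierCoeff_ne_zero (f := f) (s := s)
    (c := (AddCircle.toCircle (g s) : ℂ)) (fun θ => by
      simp only [hf, ContinuousMap.coe_mk]
      rw [hadd, AddCircle.toCircle_add, Circle.coe_mul, mul_comm]) hm
  rw [mFourier_eq_toCircle] at h1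
  exact AddCircle.injective_toCircle one_ne_zero (Circle.coe_injective h1)

/-! ### Integer matrices acting on the torus -/

/-- The endomorphism of the torus induced by an integer matrix. -/
def matrixEndo {n : ℕ} (B : Matrix (Fin n) (Fin n) ℤ) (θ : Torus n) : Torus n :=
  fun i => ∑ j, B i j • θ j

theorem matrixEndo_proj {n : ℕ} (B : Matrix (Fin n) (Fin n) ℤ) (x : Fin n → ℝ) :
    matrixEndo B (proj x) = proj fun i => ∑ j, (B i j : ℝ) * x j :=
  funext fun i => sum_zsmul_proj (B i) x

theorem matrixEndo_add {n : ℕ} (B : Matrix (Fin n) (Fin n) ℤ) (θ s : Torus n) :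
    matrixEndo B (θ + s) = matrixEndo B θ + matrixEndo B s := by
  funext i
  simp [matrixEndo, Finset.sum_add_distrib]

theorem matrixEndo_one {n : ℕ} (θ : Torus n) : matrixEndo 1 θ = θ := by
  funext i
  simp [matrixEndo, Matrix.one_apply]

theorem matrixEndo_mul {n : ℕ} (B C : Matrix (Fin n) (Fin n) ℤ) (θ : Torus n) :
    matrixEndo (B * C) θ = matrixEndo B (matrixEndo C θ) := by
  funext i
  simp only [matrixEndo, Matrix.mul_apply, Finset.sum_smul, Finset.smul_sum, mul_smul]
  exact Finset.sum_comm

theorem matrixEndo_injective {n : ℕ} : Function.Injective (matrixEndo (n := n)) := by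
  intro B C h
  ext i j
  have h1 : (((B i j : ℝ) - C i j : ℝ)) = 0 := by
    refine eq_zero_of_forall_mul_mem_int fun t => ?_
    -- The line in direction `j` isolates column `j`: entry differences times any real `t` are
    -- integers.
    have h2 := congrFun h (proj (Pi.single j t))
    rw [matrixEndo_proj, matrixEndo_proj, proj_eq_iff] at h2
    obtain ⟨m, hm⟩ := h2
    refine ⟨m i, ?_⟩
    have h3 := hm i
    simp [Pi.single_apply] at h3
    linear_combination h3
  exact_mod_cast sub_eq_zero.1 h1

/-! ### Rigidity of generalized symmetries -/

/-- Generalized symmetries of an irrational linear flow are affine. -/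
theorem exists_eq_matrixEndo_add {n : ℕ} (hn : 2 ≤ n) {a : Fin n → ℝ}
    (ha : RationallyIndependent a) {R : Diff n} (hR : R ∈ symmetryGroup a) :
    ∃ B : Matrix (Fin n) (Fin n) ℤ, ∀ θ, R θ = matrixEndo B θ + R 0 := by
  obtain ⟨α, hα⟩ := exists_isMultiplier hn ha hR
  have hflow : ∀ (t : ℝ) θ, R (θ + proj (t • a)) = R θ + proj ((α * t : ℝ) • a) :=
    fun t θ => congrArg (fun Q : Diff n => Q θ) (hα t)
  have hinv : ∀ i θ s, R (θ + s) i - R θ i = R s i - R 0 i := by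
    intro i θ s
    -- The invariance lemma concerns complex functions, so the circle-valued displacement is passed
    -- through the injective `toCircle`. Its constant value is then read off at `θ = 0`.
    have hc : Continuous fun θ => (AddCircle.toCircle (R (θ + s) i - R θ i) : ℂ) := by
      refine continuous_induced_dom.comp (AddCircle.continuous_toCircle.comp ?_)
      have hRi : Continuous fun θ => R θ i := (continuous_apply i).comp R.continuous
      exact (hRi.comp (continuous_id.add continuous_const)).sub hRi
    have h := eq_of_flow_invariant ha hc (fun t θ => by
      simp only [add_right_comm θ _ s, hflow, Pi.add_apply, add_sub_add_right_eq_sub]) θ 0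
    have h2 := AddCircle.injective_toCircle one_ne_zero (Circle.coe_injective h)
    simpa using h2
  have hex : ∀ i, ∃ m : Fin n → ℤ, ∀ θ, R θ i - R 0 i = ∑ j, m j • θ j := by
    intro i
    refine exists_eq_sum_zsmul (g := fun θ => R θ i - R 0 i)
      (((continuous_apply i).comp R.continuous).sub continuous_const) fun θ s => ?_
    -- Constancy of the displacement is exactly additivity of `R - R 0`.
    rw [← hinv i θ s]
    abel
  choose B hB using hex
  refine ⟨B, fun θ => funext fun i => ?_⟩
  exact sub_eq_iff_eq_add.1 (hB i θ)

theorem linMap_matrixEndo {n : ℕ} (B : Matrix.GeneralLinearGroup (Fin n) ℤ) (x : Fin n → ℝ) :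
    matrixEndo (B : Matrix (Fin n) (Fin n) ℤ) (proj x) = proj (linMap B x) := by
  rw [matrixEndo_proj, linMap_apply]

/-- Composing the two affine maps gives `θ = B C θ + const`. At `θ = 0` the constant vanishes, so `B
* C` acts as the identity, and the action is faithful. -/
theorem mul_eq_one_of_matrixEndo_add {n : ℕ} {R : Diff n} {B C : Matrix (Fin n) (Fin n) ℤ}
    {b c : Torus n} (hB : ∀ θ, R θ = matrixEndo B θ + b)
    (hC : ∀ θ, R⁻¹ θ = matrixEndo C θ + c) : B * C = 1 := by
  apply matrixEndo_injective
  have h : ∀ θ, θ = matrixEndo (B * C) θ + (matrixEndo B c + b) := by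
    intro θ
    conv_lhs => rw [← diff_apply_inv_self R θ, hC, hB, matrixEndo_add, ← matrixEndo_mul, add_assoc]
  have h0 := h 0
  rw [show matrixEndo (B * C) (0 : Torus n) = 0 by funext i; simp [matrixEndo], zero_add] at h0
  funext θ
  have := h θ
  rw [← h0, add_zero] at this
  rw [← this, matrixEndo_one]

/-- Because `S_φ` is a group, `R⁻¹` is affine too, and its linear part supplies the integer inverse.
This is the source of surjectivity of `ν_φ`. -/
theorem exists_hasLiftDeriv {n : ℕ} (hn : 2 ≤ n) {a : Fin n → ℝ}
    (ha : RationallyIndependent a) {R : Diff n} (hR : R ∈ symmetryGroup a) :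
    ∃ B : Matrix.GeneralLinearGroup (Fin n) ℤ, HasLiftDeriv R B := by
  obtain ⟨B, hB⟩ := exists_eq_matrixEndo_add hn ha hR
  obtain ⟨C, hC⟩ := exists_eq_matrixEndo_add hn ha (inv_mem hR)
  have hBC := mul_eq_one_of_matrixEndo_add hB hC
  refine ⟨⟨B, C, hBC, mul_eq_one_comm.1 hBC⟩, (hasLiftDeriv_iff _ _).2 ?_⟩
  obtain ⟨c, hc⟩ := proj_surjective (R 0)
  refine ⟨c, fun x => ?_⟩
  rw [hB, ← hc, proj_add, ← linMap_matrixEndo]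

/-! ### Linear automorphisms as generalized symmetries -/

/-- The action of `GL(n, ℤ)` on the torus by linear automorphisms. -/
def linearDiff (n : ℕ) : Matrix.GeneralLinearGroup (Fin n) ℤ →* Diff n where
  toFun B :=
    { toFun := matrixEndo (B : Matrix (Fin n) (Fin n) ℤ)
      invFun := matrixEndo (B⁻¹ : Matrix.GeneralLinearGroup (Fin n) ℤ).val
      left_inv := fun θ => by rw [← matrixEndo_mul, ← Units.val_mul, inv_mul_cancel,
        Units.val_one, matrixEndo_one]
      right_inv := fun θ => by rw [← matrixEndo_mul, ← Units.val_mul, mul_inv_cancel,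
        Units.val_one, matrixEndo_one]
      contMDiff_toFun := contMDiff_of_lift (linMap B).contDiff fun x =>
        (linMap_matrixEndo B x).symm
      contMDiff_invFun := contMDiff_of_lift (linMap B⁻¹).contDiff fun x =>
        (linMap_matrixEndo B⁻¹ x).symm }
  map_one' := Diffeomorph.ext matrixEndo_one
  map_mul' B C := Diffeomorph.ext fun θ => matrixEndo_mul B.val C.val θ

theorem linearDiff_proj {n : ℕ} (B : Matrix.GeneralLinearGroup (Fin n) ℤ) (x : Fin n → ℝ) :
    linearDiff n B (proj x) = proj (linMap B x) :=
  linMap_matrixEndo B x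

theorem isLift_linMap {n : ℕ} (B : Matrix.GeneralLinearGroup (Fin n) ℤ) :
    IsLift (linMap B) (linearDiff n B) :=
  ⟨(linMap B).continuous, linearDiff_proj B⟩

theorem hasLiftDeriv_linearDiff {n : ℕ} (B : Matrix.GeneralLinearGroup (Fin n) ℤ) :
    HasLiftDeriv (linearDiff n B) B :=
  ⟨linMap B, isLift_linMap B, fun _ => (linMap B).hasFDerivAt⟩

/-- Linearity carries `x + ta` to `B x + tαa`, so the eigenvector relation alone gives the
conjugation of the flow. -/
theorem linearDiff_isMultiplier {n : ℕ} {a : Fin n → ℝ}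
    {B : Matrix.GeneralLinearGroup (Fin n) ℤ} {α : ℝˣ} (h : linMap B a = (α : ℝ) • a) :
    IsMultiplier a (linearDiff n B) α := by
  intro t
  refine Diffeomorph.ext fun θ => ?_
  obtain ⟨x, rfl⟩ := proj_surjective θ
  rw [diff_mul_apply, diff_mul_apply, linearFlow_apply, linearFlow_apply, linearDiff_proj,
    ← proj_add, linearDiff_proj, ← proj_add, map_add, map_smul, h, smul_smul, mul_comm t]

theorem IsMultiplier.mem_symmetryGroup {n : ℕ} {a : Fin n → ℝ} {R : Diff n} {α : ℝˣ}
    (h : IsMultiplier a R α) : R ∈ symmetryGroup a := by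
  refine Subgroup.mem_normalizer_iff.2 fun Q => ⟨?_, ?_⟩
  · rintro ⟨t, rfl⟩
    exact ⟨α * t, by rw [h t, mul_inv_cancel_right]⟩
  · rintro ⟨t, ht⟩
    -- The normalizer condition is two-sided: `α ≠ 0` lets time be rescaled back.
    refine ⟨(α : ℝ)⁻¹ * t, mul_left_cancel (a := R) ?_⟩
    rw [h, mul_inv_cancel_left₀ α.ne_zero, ht, inv_mul_cancel_right]

/-! ### Bijectivity of `ν_φ` and the lifted action of `Π_φ` -/

theorem linMap_eq_smul_of_mem {n : ℕ} (hn : 2 ≤ n) {a : Fin n → ℝ}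
    (ha : RationallyIndependent a) (B : liftMatrixGroup a) :
    linMap B.1 a = ((liftMultiplier hn ha B : ℝˣ) : ℝ) • a := by
  obtain ⟨R, hR, hB⟩ := B.2
  rw [liftMultiplier_eq hn ha B ⟨R, hR⟩ hB]
  exact linMap_eq_multiplier_smul hn ha ⟨R, hR⟩ hB

/-- Each row of `B - C` is an integer relation among the `a_j`. -/
theorem RationallyIndependent.eq_of_linMap_eq {n : ℕ} {a : Fin n → ℝ}
    (ha : RationallyIndependent a) {B C : Matrix.GeneralLinearGroup (Fin n) ℤ}
    (h : linMap B a = linMap C a) : B = C := by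
  apply Units.ext
  ext i j
  have h1 := congrFun h i
  rw [linMap_apply, linMap_apply] at h1
  refine sub_eq_zero.1 (ha (fun j => B i j - C i j) ?_ j)
  simp only [Int.cast_sub, sub_mul, Finset.sum_sub_distrib]
  exact sub_eq_zero.2 h1

/-- Injective because `ν_φ(B)` determines `B a`, hence `B`; surjective because every symmetry has a
lift with constant derivative in `GL(n, ℤ)`. -/
theorem liftMultiplier_bijective {n : ℕ} (hn : 2 ≤ n) {a : Fin n → ℝ}
    (ha : RationallyIndependent a) : Function.Bijective (liftMultiplier hn ha) := by
  constructor
  · intro B C h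
    apply Subtype.ext
    apply ha.eq_of_linMap_eq
    rw [linMap_eq_smul_of_mem hn ha, linMap_eq_smul_of_mem hn ha, h]
  · rintro ⟨_, R, rfl⟩
    obtain ⟨B, hB⟩ := exists_hasLiftDeriv hn ha R.2
    exact ⟨⟨B, R, R.2, hB⟩, Subtype.ext (liftMultiplier_eq hn ha _ R hB)⟩

/-- The action of `Π_φ` on the torus by generalized symmetries. -/
def linearSymmetry {n : ℕ} (hn : 2 ≤ n) {a : Fin n → ℝ} (ha : RationallyIndependent a) :
    liftMatrixGroup a →* symmetryGroup a :=
  ((linearDiff n).comp (liftMatrixGroup a).subtype).codRestrict (symmetryGroup a) fun B =>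
    (linearDiff_isMultiplier (linMap_eq_smul_of_mem hn ha B)).mem_symmetryGroup

/-- Since `ν_φ(B)` may be computed from any symmetry with derivative `B`, the linear automorphism
itself can be used. -/
theorem multiplierRep_linearSymmetry {n : ℕ} (hn : 2 ≤ n) {a : Fin n → ℝ}
    (ha : RationallyIndependent a) (B : liftMatrixGroup a) :
    multiplierRep hn ha (linearSymmetry hn ha B) = liftMultiplier hn ha B :=
  (liftMultiplier_eq hn ha B _ (hasLiftDeriv_linearDiff B.1)).symm

end TorusFlow

end

/-! ### The splitting -/

theorem mainTheorem2 (n : ℕ) (hn : 2 ≤ n) (a : Fin n → ℝ)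
    (ha : TorusFlow.RationallyIndependent a) :
    ∃ hν : Function.Bijective (TorusFlow.liftMultiplier hn ha),
      ∀ (Λ : Subgroup ℝˣ) (hΛ : Λ ≤ (TorusFlow.multiplierRep hn ha).range),
        ∃ h : (TorusFlow.multiplierExtension hn ha Λ hΛ).Splitting,
          ∀ α : Λ,
            TorusFlow.IsLift
              (TorusFlow.linMap
                ((MulEquiv.ofBijective (TorusFlow.liftMultiplier hn ha) hν).symm
                  ⟨α, hΛ α.2⟩ : TorusFlow.liftMatrixGroup a))
              ((h α : TorusFlow.symmetryGroup a) : TorusFlow.Diff n) := by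
  have hν := TorusFlow.liftMultiplier_bijective hn ha
  refine ⟨hν, fun Λ hΛ => ?_⟩
  let e := (MulEquiv.ofBijective (TorusFlow.liftMultiplier hn ha) hν).symm
  let σ : Λ →* TorusFlow.symmetryGroup a :=
    (TorusFlow.linearSymmetry hn ha).comp (e.toMonoidHom.comp (Subgroup.inclusion hΛ))
  -- Here `e` is already `ν_φ⁻¹`, so `e.symm` is `ν_φ` and the identity used is `ν_φ(ν_φ⁻¹(α)) = α`.
  -- It yields both membership in `ρ_φ⁻¹(Λ)` and the section property.
  have hσ : ∀ α : Λ, TorusFlow.multiplierRep hn ha (σ α) = α := fun α =>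
    (TorusFlow.multiplierRep_linearSymmetry hn ha _).trans
      (congrArg Subtype.val (e.symm_apply_apply (Subgroup.inclusion hΛ α)))
  refine ⟨⟨σ.codRestrict (Λ.comap (TorusFlow.multiplierRep hn ha)) fun α => ?_, fun α => ?_⟩,
    fun α => ?_⟩
  · rw [Subgroup.mem_comap, hσ]
    exact α.2
  · exact Subtype.ext (hσ α)
  · exact TorusFlow.isLift_linMap _
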